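/- Let $A$ be a finite alphabet, and let $\tau=(\tau,A,a)$ be a substitution, i.e. a morphism $\tau:A\to A^+$ together with a letter $a$ such that the first letter of $\tau(a)$ is $a$. Suppose that $\tau$ is primitive (some power of the matrix whose $(i,j)$ entry is the number of occurrences of $i$ in $\tau(j)$ has only positive entries), and that its fixed point $X$ (the sequence $X\in A^{\mathbb N}$ with $X_0=a$ and $\tau(X)=X$) is not ultimately periodic. For a sequence $Y$ let $L(Y)$ be the set of its finite factors. For a non-empty prefix $u$ of $X$, a return word on $u$ is a word $X_iX_{i+1}\cdots X_{j-1}$ where $i<j$ are two successive occurrences of $u$ in $X$; the sequence $X$ is a concatenation $m_0m_1m_2\cdots$ of return words on $u$, where $m_n$ lies between two successive occurrences of $u$. Let $R_u$ be an alphabet that numbers the (finitely many) return words on $u$ in the order of their first appearance in $(m_n)_{n\ge 0}$, and let $\Theta_u:R_u^*\to A^*$ be the morphism that sends each letter of $R_u$ to the corresponding return word, so that $\Theta_u(R_u^*)$ is the set of all concatenations of return words on $u$. There exists an integer $n_0$ such that the following holds for every prefix $u$ of $X$ of length larger than $n_0$. (i) $\tau$ is injective on $L(X)\cap\Theta_u(R_u^*)$.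 (ii) There are a unique sequence $\mathcal D_u(X)\in R_u^{\mathbb N}$ with $\Theta_u(\mathcal D_u(X))=X$ (the derived sequence) and a unique morphism $\tau_u:R_u\to R_u^*$ with $\Theta_u\tau_u=\tau\Theta_u$ (the return substitution), and $\tau_u$ is injective on $L(\mathcal D_u(X))$. -/

import Mathlib

/-- The word `X_k X_{k+1} ⋯ X_{k+n-1}`. -/
def factorAt {A : Type*} (X : ℕ → A) (k n : ℕ) : List A :=
  (List.range n).map fun i => X (k + i)

/-- The language `L(X)`: the set of all (possibly empty) factors of the sequence `X`. -/
def language {A : Type*} (X : ℕ → A) : Set (List A) :=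
  {w | ∃ k n : ℕ, w = factorAt X k n}

/-- The word `w` is a prefix of the sequence `X`. -/
def IsPrefixOf {A : Type*} (w : List A) (X : ℕ → A) : Prop :=
  w = factorAt X 0 w.length

/-- `X` is ultimately periodic: `X = u v^ω` with `|u| = N` and `|v| = p > 0`. -/
def UltimatelyPeriodic {A : Type*} (X : ℕ → A) : Prop :=
  ∃ N p : ℕ, 0 < p ∧ ∀ n ≥ N, X (n + p) = X n

/-- The extension by concatenation of a morphism `f : A → B^*` to a map `A^* → B^*`. -/
def wordMap {A B : Type*} (f : A → List B) (w : List A) : List B :=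
  w.flatMap f

/-- `f(X) = Y`, for a morphism `f : A → B^+` and sequences `X` on `A`, `Y` on `B`: all the words
`f(X_0) f(X_1) ⋯ f(X_{n-1})` are prefixes of `Y`. -/
def MapsSeqTo {A B : Type*} (f : A → List B) (X : ℕ → A) (Y : ℕ → B) : Prop :=
  ∀ n : ℕ, IsPrefixOf (wordMap f (factorAt X 0 n)) Y

/-- A substitution `(τ, A, a)`: a morphism `τ : A → A^+` and a letter `a` such that `τ(a)` begins
with `a`. -/
structure Substitution (A : Type*) where
  /-- the image of a letter -/
  image : A → List A
  /-- the distinguished letter `a` -/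
  start : A
  image_ne_nil : ∀ b, image b ≠ []
  head_image_start : (image start).head? = some start

/-- The matrix whose `(i, j)` entry is the number of occurrences of `i` in `τ(j)`. -/
def Substitution.matrix {A : Type*} [DecidableEq A] (τ : Substitution A) : Matrix A A ℝ :=
  Matrix.of fun i j => ((τ.image j).count i : ℝ)

/-- A substitution is primitive if its matrix has a power with positive coefficients. -/
def Substitution.IsPrimitive {A : Type*} [Fintype A] [DecidableEq A] (τ : Substitution A) : Prop :=
  τ.matrix.IsPrimitive

/-- `X` is the fixed point of the substitution `(τ, A, a)`: `X_0 = a` and `τ(X) = X`. -/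
def Substitution.IsFixedPoint {A : Type*} (τ : Substitution A) (X : ℕ → A) : Prop :=
  X 0 = τ.start ∧ MapsSeqTo τ.image X X

/-- The integer `i` is an occurrence of the word `u` in the sequence `X`. -/
def IsOccurrence {A : Type*} (X : ℕ → A) (u : List A) (i : ℕ) : Prop :=
  factorAt X i u.length = u

/-- The set of return words on `u`: the words `X_i ⋯ X_{j-1}`, where `i < j` are two successive
occurrences of `u` in `X`. -/
def returnWords {A : Type*} (X : ℕ → A) (u : List A) : Set (List A) :=
  {v | ∃ i j : ℕ, i < j ∧ IsOccurrence X u i ∧ IsOccurrence X u j ∧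
    (∀ k, i < k → k < j → ¬ IsOccurrence X u k) ∧ v = factorAt X i (j - i)}

/-- The `n`-th word `m_n` in the decomposition `X = m_0 m_1 m_2 ⋯` of `X` into return words on its
prefix `u`: the word between the `n`-th and the `(n+1)`-st occurrences of `u`. -/
noncomputable def returnBlock {A : Type*} (X : ℕ → A) (u : List A) (n : ℕ) : List A :=
  factorAt X (Nat.nth (IsOccurrence X u) n)
    (Nat.nth (IsOccurrence X u) (n + 1) - Nat.nth (IsOccurrence X u) n)

/-- `n` is the first index at which the return word `m_n` appears in `(m_n)`. -/
def IsFirstAppearance {A : Type*} (X : ℕ → A) (u : List A) (n : ℕ) : Prop :=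
  ∀ k < n, returnBlock X u k ≠ returnBlock X u n

/-- The alphabet `R_{X,u}`, with `Card(returnWords X u)` letters (numbered from `0`). -/
abbrev ReturnAlphabet {A : Type*} (X : ℕ → A) (u : List A) : Type :=
  Fin (returnWords X u).ncard

/-- The morphism `Θ_{X,u}`: it enumerates the return words on `u` in the order of their first
appearance in `(m_n)`. -/
noncomputable def returnCoding {A : Type*} (X : ℕ → A) (u : List A) (r : ReturnAlphabet X u) :
    List A :=
  returnBlock X u (Nat.nth (IsFirstAppearance X u) r)

/-- `Y` is the derived sequence of `X` on `u`, characterized by `Θ_{X,u}(Y) = X`. -/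
def IsDerivedSequence {A : Type*} (X : ℕ → A) (u : List A) (Y : ℕ → ReturnAlphabet X u) : Prop :=
  MapsSeqTo (returnCoding X u) Y X

/-- `σ` is the return substitution `τ_u`, characterized by `Θ_u τ_u = τ Θ_u`. -/
def IsReturnSubstitution {A : Type*} (τ : Substitution A) (X : ℕ → A) (u : List A)
    (σ : ReturnAlphabet X u → List (ReturnAlphabet X u)) : Prop :=
  ∀ r : ReturnAlphabet X u,
    wordMap (returnCoding X u) (σ r) = wordMap τ.image (returnCoding X u r)

/-- The words of length `n` at the positions `a` and `b` of `X` are equal. -/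
def Agree {A : Type*} (X : ℕ → A) (a b n : ℕ) : Prop :=
  ∀ t < n, X (a + t) = X (b + t)

namespace Agree

variable {A : Type*} {X : ℕ → A} {a b c n m : ℕ}

theorem symm (h : Agree X a b n) : Agree X b a n := fun t ht => (h t ht).symm

theorem trans (h : Agree X a b n) (h' : Agree X b c n) : Agree X a c n :=
  fun t ht => (h t ht).trans (h' t ht)

theorem mono (h : Agree X a b n) (hm : m ≤ n) : Agree X a b m :=
  fun t ht => h t (ht.trans_le hm)

theorem eq_of_offset (h : Agree X a b n) {i j : ℕ} (hi : a ≤ i) (hn : i < a + n)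
    (hij : i + b = j + a) : X i = X j := by
  have := h (i - a) (by omega)
  rwa [show a + (i - a) = i by omega, show b + (i - a) = j by omega] at this

theorem shift (h : Agree X a b n) {i j : ℕ} (hi : a ≤ i) (hn : i + m ≤ a + n)
    (hij : i + b = j + a) : Agree X i j m :=
  fun t ht => h.eq_of_offset (by omega) (by omega) (by omega)

theorem append (h : Agree X a b n) (h' : Agree X (a + n) (b + n) m) : Agree X a b (n + m) := by
  intro t ht
  rcases lt_or_ge t n with h1 | h1
  · exact h t h1
  · exact h'.eq_of_offset (by omega) (by omega) (by omega)

end Agree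

/-- The sequence `X` is fixed by a non-erasing morphism, and `f k` is the position at which the
image of the letter `X k` begins. -/
structure IsCutting {A : Type*} (X : ℕ → A) (f : ℕ → ℕ) : Prop where
  strictMono : StrictMono f
  map_zero : f 0 = 0
  block : ∀ k l, X k = X l → f (k + 1) + f l = f (l + 1) + f k ∧
    Agree X (f k) (f l) (f (k + 1) - f k)

theorem StrictMono.exists_between {f : ℕ → ℕ} (hf : StrictMono f) (h0 : f 0 = 0) (i : ℕ) :
    ∃ k, f k ≤ i ∧ i < f (k + 1) := by
  induction i with
  | zero => exact ⟨0, h0.le, h0 ▸ hf (by omega)⟩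
  | succ i ih =>
    obtain ⟨k, h1, h2⟩ := ih
    rcases Nat.lt_or_ge (i + 1) (f (k + 1)) with h | h
    · exact ⟨k, by omega, h⟩
    · exact ⟨k + 1, h, by have := hf (show k + 1 < k + 1 + 1 by omega); omega⟩

namespace IsCutting

variable {A : Type*} {X : ℕ → A} {f g : ℕ → ℕ}

theorem map_agree (hf : IsCutting X f) {a b n : ℕ} (h : Agree X a b n) :
    (∀ t ≤ n, f (a + t) + f b = f (b + t) + f a) ∧ Agree X (f a) (f b) (f (a + n) - f a) := by
  induction n with
  | zero =>
    refine ⟨fun t ht => ?_, fun t ht => by simp at ht⟩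
    obtain rfl : t = 0 := by omega
    simp [add_comm]
  | succ n ih =>
    obtain ⟨h1, h2⟩ := ih (h.mono (by omega))
    obtain ⟨h3, h4⟩ := hf.block _ _ (h n (by omega))
    have h5 := h1 n le_rfl
    have ha : f a ≤ f (a + n) := hf.strictMono.monotone (by omega)
    have hb : f b ≤ f (b + n) := hf.strictMono.monotone (by omega)
    have ha' : f (a + n) ≤ f (a + n + 1) := hf.strictMono.monotone (by omega)
    refine ⟨fun t ht => ?_, ?_⟩
    · rcases Nat.lt_or_ge n t with h' | h'
      · obtain rfl : t = n + 1 := by omega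
        rw [← add_assoc, ← add_assoc]
        omega
      · exact h1 t h'
    · intro t ht
      rw [← add_assoc] at ht
      rcases Nat.lt_or_ge t (f (a + n) - f a) with h' | h'
      · exact h2 t h'
      · exact h4.eq_of_offset (by omega) (by omega) (by omega)

theorem comp (hf : IsCutting X f) (hg : IsCutting X g) : IsCutting X (f ∘ g) where
  strictMono := hf.strictMono.comp hg.strictMono
  map_zero := by simp [hf.map_zero, hg.map_zero]
  block k l h := by
    obtain ⟨h1, h2⟩ := hg.block k l h
    have hk : g k ≤ g (k + 1) := hg.strictMono.monotone (by omega)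
    have hl : g l ≤ g (l + 1) := hg.strictMono.monotone (by omega)
    obtain ⟨h3, h4⟩ := hf.map_agree h2
    have h5 := h3 _ le_rfl
    rw [show g k + (g (k + 1) - g k) = g (k + 1) by omega] at h4 h5
    rw [show g l + (g (k + 1) - g k) = g (l + 1) by omega] at h5
    exact ⟨h5, h4⟩

theorem id (X : ℕ → A) : IsCutting X id where
  strictMono := strictMono_id
  map_zero := rfl
  block k l h := ⟨by simp only [id_eq]; omega, fun t ht => by
    obtain rfl : t = 0 := by simp only [id_eq] at ht; omega
    simpa using h⟩

theorem iterate (hf : IsCutting X f) (n : ℕ) : IsCutting X f^[n] := by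
  induction n with
  | zero => exact IsCutting.id X
  | succ n ih => rw [Function.iterate_succ]; exact ih.comp hf

theorem exists_le_add [Finite A] (hf : IsCutting X f) : ∃ M, ∀ k, f (k + 1) ≤ f k + M := by
  classical
  have : Fintype A := Fintype.ofFinite A
  have h : ∀ c : A, ∃ d, ∀ k, X k = c → f (k + 1) ≤ f k + d := by
    intro c
    by_cases hc : ∃ k, X k = c
    · obtain ⟨k, hk⟩ := hc
      refine ⟨f (k + 1) - f k, fun l hl => ?_⟩
      have := (hf.block k l (hk.trans hl.symm)).1
      have := hf.strictMono (Nat.lt_succ_self k)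
      simp only [Nat.succ_eq_add_one] at this
      omega
    · exact ⟨0, fun k hk => (hc ⟨k, hk⟩).elim⟩
  choose d hd using h
  exact ⟨∑ c, d c, fun k => (hd _ k rfl).trans (Nat.add_le_add_left
    (Finset.single_le_sum (f := d) (fun _ _ => Nat.zero_le _) (Finset.mem_univ _)) _)⟩

end IsCutting

theorem map_add_le_of_map_succ_le {f : ℕ → ℕ} {M : ℕ} (h : ∀ k, f (k + 1) ≤ f k + M) (k n : ℕ) :
    f (k + n) ≤ f k + M * n := by
  induction n with
  | zero => simp
  | succ n ih => have := h (k + n); rw [← add_assoc]; rw [mul_add]; omega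

theorem add_mul_le_map_add {f : ℕ → ℕ} {M C : ℕ} (h : ∀ k, f k * C + M ≤ f (k + 1) * C) (k n : ℕ) :
    f k * C + M * n ≤ f (k + n) * C := by
  induction n with
  | zero => simp
  | succ n ih => have := h (k + n); rw [← add_assoc]; rw [mul_add]; omega

/-- Every letter of `X` occurs in the image of every letter of `X` under the morphism whose
cutting function is `f`. -/
def IsMixing {A : Type*} (X : ℕ → A) (f : ℕ → ℕ) : Prop :=
  ∀ k l, ∃ t, f k ≤ t ∧ t < f (k + 1) ∧ X t = X l

namespace IsCutting

variable {A : Type*} {X : ℕ → A} {f g : ℕ → ℕ}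

theorem isMixing_iterate_add (hf : IsCutting X f) {p : ℕ} (hm : IsMixing X f^[p]) (n : ℕ) :
    IsMixing X f^[p + n] := by
  intro k l
  obtain ⟨t, h1, h2, h3⟩ := hm (f^[n] k) l
  refine ⟨t, ?_, h2.trans_le ?_, h3⟩
  · rwa [Function.iterate_add_apply]
  · rw [Function.iterate_add_apply]
    exact (hf.iterate p).strictMono.monotone ((hf.iterate n).strictMono (Nat.lt_succ_self k))

/-- The images of all letters under all powers of a primitive morphism have comparable lengths. -/
theorem exists_comparable [Finite A] (hf : IsCutting X f) {p : ℕ} (hm : IsMixing X f^[p]) :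
    ∃ C, 0 < C ∧ ∀ n k l, f^[n] (k + 1) + C * f^[n] l ≤ f^[n] k + C * f^[n] (l + 1) := by
  obtain ⟨M, hM⟩ := (hf.iterate p).exists_le_add
  refine ⟨M + 1, by omega, fun n k l => ?_⟩
  obtain ⟨t, h1, h2, h3⟩ := hm l k
  have hn := (hf.iterate n).strictMono
  have e1 := ((hf.iterate n).block _ _ h3).1
  have e2 : f^[n] (f^[p] l) ≤ f^[n] t := hn.monotone h1
  have e3 : f^[n] (t + 1) ≤ f^[n] (f^[p] (l + 1)) := hn.monotone h2
  rw [(Function.Commute.iterate_iterate_self f n p).eq] at e2 e3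
  have e4 := map_add_le_of_map_succ_le hM (f^[n] l) (f^[n] (l + 1) - f^[n] l)
  have e5 : f^[n] l < f^[n] (l + 1) := hn (Nat.lt_succ_self l)
  rw [show f^[n] l + (f^[n] (l + 1) - f^[n] l) = f^[n] (l + 1) by omega] at e4
  obtain ⟨d, hd⟩ := Nat.exists_eq_add_of_lt e5
  rw [hd] at e4 e3 ⊢
  rw [show f^[n] l + d + 1 - f^[n] l = d + 1 by omega] at e4
  nlinarith

end IsCutting

namespace IsCutting

variable {A : Type*} {X : ℕ → A} {f g : ℕ → ℕ}

theorem iterate_one_le (hf : IsCutting X f) {C : ℕ}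
    (hC : ∀ n k l, f^[n] (k + 1) + C * f^[n] l ≤ f^[n] k + C * f^[n] (l + 1)) (n k : ℕ) :
    f^[n] (k + 1) ≤ f^[n] k + C * f^[n] 1 ∧ f^[n] 1 + C * f^[n] k ≤ C * f^[n] (k + 1) := by
  have h1 := hC n k 0
  have h2 := hC n 0 k
  rw [(hf.iterate n).map_zero] at h1 h2
  simp only [zero_add] at h1 h2
  exact ⟨by omega, by omega⟩

theorem _root_.IsMixing.exists_lt_iterate_one {p : ℕ} (hm : IsMixing X f^[p])
    (hX : ∃ i, X i ≠ X (i + 1)) (m : ℕ) : ∃ n, m < f^[n] 1 := by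
  obtain ⟨i, hi⟩ := hX
  have h2 : ∀ k, f^[p] k + 2 ≤ f^[p] (k + 1) := by
    intro k
    obtain ⟨t, h1, h2, h3⟩ := hm k i
    obtain ⟨s, h4, h5, h6⟩ := hm k (i + 1)
    have : t ≠ s := by rintro rfl; exact hi (h3.symm.trans h6)
    omega
  have h3 : ∀ k, 2 * k ≤ f^[p] k := by
    intro k
    induction k with
    | zero => simp
    | succ k ih => have := h2 k; omega
  have h4 : ∀ m, m < f^[p * m] 1 := by
    intro m
    induction m with
    | zero => simp
    | succ m ih =>
      rw [mul_add, mul_one, add_comm (p * m) p, Function.iterate_add_apply]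
      have := h3 (f^[p * m] 1)
      omega
  exact ⟨_, h4 m⟩

/-- All two-letter words of `X` occur in the image of each letter under a power. -/
theorem exists_pairs [Finite A] (hf : IsCutting X f) {p : ℕ} (hm : IsMixing X f^[p])
    (hX : ∃ i, X i ≠ X (i + 1)) :
    ∃ q, ∀ k i, ∃ t, f^[q] k ≤ t ∧ t + 2 ≤ f^[q] (k + 1) ∧ Agree X i t 2 := by
  have hfin : (Set.range fun i => (X i, X (i + 1))).Finite := Set.toFinite _
  obtain ⟨T, hT⟩ : ∃ T, ∀ i, ∃ t < T, (X t, X (t + 1)) = (X i, X (i + 1)) := by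
    choose r hr using fun y : Set.range fun i => (X i, X (i + 1)) => y.2
    have := hfin.to_subtype
    obtain ⟨T, hT⟩ := (Set.finite_range r).bddAbove
    refine ⟨T + 1, fun i => ⟨r ⟨_, i, rfl⟩, ?_, hr ⟨_, i, rfl⟩⟩⟩
    exact Nat.lt_succ_of_le (hT ⟨_, rfl⟩)
  obtain ⟨n, hn⟩ := hm.exists_lt_iterate_one hX (T + 1)
  refine ⟨n + p, fun k i => ?_⟩
  obtain ⟨t, ht, hti⟩ := hT i
  obtain ⟨s, h1, h2, h3⟩ := hm k 0
  obtain ⟨h4, h5⟩ := ((hf.iterate n).block _ _ h3)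
  rw [(hf.iterate n).map_zero, add_zero] at h4
  have hmono := (hf.iterate n).strictMono.monotone
  have h6 := hmono h1
  have h7 := hmono h2
  rw [zero_add] at h4
  rw [Function.iterate_add_apply, Function.iterate_add_apply]
  have h8 : Agree X 0 (f^[n] s) (f^[n] 1) := by
    rw [(hf.iterate n).map_zero] at h5
    exact h5.symm.mono (by omega)
  simp only [Prod.mk.injEq] at hti
  refine ⟨f^[n] s + t, by omega, ?_, ?_⟩
  · simp only [Nat.succ_eq_add_one] at h7
    omega
  · intro j hj
    have h9 := h8 (t + j) (by omega)
    rw [zero_add, ← add_assoc] at h9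
    rw [← h9]
    interval_cases j
    · exact hti.1.symm
    · exact hti.2.symm

/-- Linear recurrence of primitive fixed points. -/
theorem exists_linear_recurrence [Finite A] (hf : IsCutting X f) {p : ℕ}
    (hm : IsMixing X f^[p]) (hX : ∃ i, X i ≠ X (i + 1)) :
    ∃ K, ∀ l, 0 < l → ∀ i a, ∃ t, a ≤ t ∧ t ≤ a + K * l ∧ Agree X i t l := by
  obtain ⟨C, hC0, hC⟩ := hf.exists_comparable hm
  obtain ⟨q, hq⟩ := hf.exists_pairs hm hX
  obtain ⟨M, hM⟩ := hf.exists_le_add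
  obtain ⟨Q, hQ⟩ := (hf.iterate q).exists_le_add
  refine ⟨2 * C * Q * ((M + 1) * C), fun l hl i a => ?_⟩
  have hex : ∃ n, C * l ≤ f^[n] 1 := by
    obtain ⟨n, hn⟩ := hm.exists_lt_iterate_one hX (C * l)
    exact ⟨n, hn.le⟩
  obtain ⟨n, hn, hn'⟩ : ∃ n, C * l ≤ f^[n] 1 ∧ f^[n] 1 ≤ (M + 1) * C * l := by
    classical
    refine ⟨Nat.find hex, Nat.find_spec hex, ?_⟩
    rcases h : Nat.find hex with _ | n
    · have : 0 < (M + 1) * C * l := by positivity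
      exact this
    · have h1 : f^[n] 1 < C * l := not_le.1 (Nat.find_min hex (by omega))
      have h2 := map_add_le_of_map_succ_le hM 0 (f^[n] 1)
      rw [hf.map_zero, zero_add] at h2
      rw [Function.iterate_succ_apply']
      nlinarith
  have hlen : ∀ k, f^[n] k + l ≤ f^[n] (k + 1) := by
    intro k
    have := (hf.iterate_one_le hC n k).2
    by_contra! hlt
    nlinarith
  obtain ⟨k, hk, hk'⟩ := (hf.iterate n).strictMono.exists_between (hf.iterate n).map_zero i
  obtain ⟨c, hc, hc'⟩ :=
    (hf.iterate (n + q)).strictMono.exists_between (hf.iterate (n + q)).map_zero a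
  obtain ⟨t, h1, h2, h3⟩ := hq (c + 1) k
  obtain ⟨h4, h5⟩ := (hf.iterate n).map_agree h3
  have hmono := (hf.iterate n).strictMono.monotone
  have h6 := hmono h1
  have h7 := hmono h2
  rw [← Function.iterate_add_apply] at h6 h7
  have h8 := hlen (k + 1)
  have h9 := h4 2 le_rfl
  have hg : f^[n + q] 1 ≤ Q * f^[n] 1 := by
    have := map_add_le_of_map_succ_le hQ 0 (f^[n] 1)
    rw [(hf.iterate q).map_zero, zero_add, zero_add] at this
    rwa [add_comm, Function.iterate_add_apply]
  have h10 := (hf.iterate_one_le hC (n + q) c).1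
  have h11 := (hf.iterate_one_le hC (n + q) (c + 1)).1
  have h12 : C * f^[n + q] 1 + C * f^[n + q] 1 ≤ 2 * C * Q * ((M + 1) * C) * l := by
    calc C * f^[n + q] 1 + C * f^[n + q] 1 = 2 * C * f^[n + q] 1 := by ring
      _ ≤ 2 * C * (Q * ((M + 1) * C * l)) :=
        Nat.mul_le_mul_left _ (hg.trans (Nat.mul_le_mul_left _ hn'))
      _ = _ := by ring
  rw [show k + 1 + 1 = k + 2 by ring] at h8
  exact ⟨f^[n] t + (i - f^[n] k), by omega, by omega, h5.shift hk (by omega) (by omega)⟩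

/-- Words of an aperiodic primitive fixed point have bounded exponent. -/
theorem exists_not_agree_add [Finite A] (hf : IsCutting X f) {p : ℕ}
    (hm : IsMixing X f^[p]) (hX : ∀ D, 0 < D → ∃ i, X i ≠ X (i + D)) :
    ∃ N, ∀ a D n, 0 < D → N * D ≤ n → ¬ Agree X a (a + D) n := by
  obtain ⟨K, hK⟩ := hf.exists_linear_recurrence hm (hX 1 one_pos)
  refine ⟨2 * K + 1, fun a D n hD hn h => ?_⟩
  obtain ⟨i, hi⟩ := hX D hD
  obtain ⟨t, h1, h2, h3⟩ := hK (D + 1) (by omega) i a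
  have h4 : X i = X t := h3 0 (by omega)
  have h5 := h3 D (by omega)
  have h6 : X t = X (t + D) := h.eq_of_offset h1 (by nlinarith) (by ring)
  exact hi (h4.trans (h6.trans h5.symm))

end IsCutting

/-- Two pairs of equal windows with slightly different offsets produce a repetition. -/
theorem Agree.exists_repetition {A : Type*} {X : ℕ → A} {a b x y n m e l : ℕ}
    (h : Agree X a b n) (h' : Agree X x y m) (ha : a ≤ x + e) (ha' : x ≤ a + e)
    (hb : b ≤ y + e) (hb' : y ≤ b + e) (hne : x + b ≠ y + a) (hn : l + 2 * e ≤ n)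
    (hm : l + e ≤ m) : ∃ q D, 0 < D ∧ D ≤ 2 * e ∧ Agree X q (q + D) l := by
  rcases Nat.lt_or_gt_of_ne hne with hlt | hlt
  · refine ⟨x + e, y + a - (x + b), by omega, by omega, fun t ht => ?_⟩
    have h1 := h'.eq_of_offset (i := x + e + t) (j := y + e + t) (by omega) (by omega) (by omega)
    have h2 := h.eq_of_offset (i := a + (y + e + t - b)) (j := y + e + t)
      (by omega) (by omega) (by omega)
    rw [h1, ← h2]
    congr 1
    omega
  · refine ⟨a + (y + e) - b, x + b - (y + a), by omega, by omega, fun t ht => ?_⟩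
    have h1 := h'.eq_of_offset (i := x + e + t) (j := y + e + t) (by omega) (by omega) (by omega)
    have h2 := h.eq_of_offset (i := a + (y + e + t - b)) (j := y + e + t)
      (by omega) (by omega) (by omega)
    rw [show a + (y + e) - b + t = a + (y + e + t - b) by omega, h2, ← h1]
    congr 1
    omega

namespace IsCutting

variable {A : Type*} {X : ℕ → A} {f g : ℕ → ℕ}

theorem map_agree_iterate_succ (hf : IsCutting X f) {x y n r k s : ℕ} (h : Agree X x y n)
    (hk : f k = s) (hs : f^[r + 1] x ≤ s) (hs' : s < f^[r + 1] (x + n)) :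
    ∃ l, f l + f^[r + 1] x = s + f^[r + 1] y := by
  obtain ⟨h1, h2⟩ := (hf.iterate r).map_agree h
  obtain ⟨h3, h4⟩ := hf.map_agree h2
  have h0 : f^[r] x ≤ f^[r] (x + n) := (hf.iterate r).strictMono.monotone (by omega)
  rw [Function.iterate_succ_apply'] at hs hs' ⊢
  rw [Function.iterate_succ_apply']
  have hx : f^[r] x ≤ k := by
    by_contra! hlt
    have := hf.strictMono hlt
    omega
  have hx' : k < f^[r] (x + n) := by
    by_contra! hlt
    have := hf.strictMono.monotone hlt
    omega
  have h5 := h3 (k - f^[r] x) (by omega)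
  rw [show f^[r] x + (k - f^[r] x) = k by omega] at h5
  exact ⟨f^[r] y + (k - f^[r] x), by omega⟩

/-- Recognizability: whether a position of an aperiodic primitive fixed point is a cutting point
depends only on a bounded window around the position. -/
theorem exists_recognizability [Finite A] (hf : IsCutting X f) {p : ℕ}
    (hm : IsMixing X f^[p]) (hX : ∀ D, 0 < D → ∃ i, X i ≠ X (i + D)) :
    ∃ L, ∀ a b k, Agree X a b (2 * L) → f k = a + L → ∃ l, f l = b + L := by
  obtain ⟨C, hC0, hC⟩ := hf.exists_comparable hm
  obtain ⟨N, hN⟩ := hf.exists_not_agree_add hm hX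
  by_contra! hcon
  let Q := 4 * C + 2 * C * N + 1
  let S := 1 + C * Q
  let R := C * S + Q + 2 * C
  have hg0 : ∀ n, 0 < f^[n] 1 := fun n => by
    have := (hf.iterate n).strictMono one_pos
    omega
  have hno : ∀ n, ∃ a b k, Agree X a b (R * f^[n] 1) ∧ f k = a + C * f^[n] 1 ∧
      ∀ l, f l ≠ b + C * f^[n] 1 := by
    intro n
    have hCR : C * f^[n] 1 ≤ R * f^[n] 1 := Nat.mul_le_mul_right _ (by omega)
    obtain ⟨a, b, k, h1, h2, h3⟩ := hcon (R * f^[n] 1)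
    refine ⟨a + (R * f^[n] 1 - C * f^[n] 1), b + (R * f^[n] 1 - C * f^[n] 1), k,
      h1.shift (by omega) (by omega) (by omega), by omega, fun l hl => h3 l (by omega)⟩
  choose a b k hab hfk hno using hno
  have hα : ∀ n, ∃ α, f^[n] α ≤ a n ∧ a n < f^[n] (α + 1) := fun n =>
    (hf.iterate n).strictMono.exists_between (hf.iterate n).map_zero _
  have hβ : ∀ n, ∃ β, f^[n] β ≤ b n ∧ b n < f^[n] (β + 1) := fun n =>
    (hf.iterate n).strictMono.exists_between (hf.iterate n).map_zero _
  choose α hα hα' using hα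
  choose β hβ hβ' using hβ
  let S' := 1 + C * R
  obtain ⟨n, m, hnm, heq⟩ : ∃ n m, n < m ∧ ∀ t < S',
      X (α n + t) = X (α m + t) ∧ X (β n + t) = X (β m + t) := by
    have key : ∀ n m, (fun t : Fin S' => (X (α n + t), X (β n + t))) =
        (fun t : Fin S' => (X (α m + t), X (β m + t))) → ∀ t < S',
        X (α n + t) = X (α m + t) ∧ X (β n + t) = X (β m + t) := fun n m h t ht => by
      simpa using congrFun h ⟨t, ht⟩
    obtain ⟨n, m, hne, h⟩ := Finite.exists_ne_map_eq_of_infinite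
      (fun n : ℕ => fun t : Fin S' => (X (α n + t), X (β n + t)))
    rcases Nat.lt_or_gt_of_ne hne with hlt | hlt
    · exact ⟨n, m, hlt, key n m h⟩
    · exact ⟨m, n, hlt, key m n h.symm⟩
  obtain ⟨r, rfl⟩ := Nat.exists_eq_add_of_lt hnm
  rw [add_assoc] at *
  -- the window of level `n`, transported to the words of level `n + (r + 1)`
  have hlow : ∀ j s, f^[j] s + R * f^[j] 1 ≤ f^[j] (s + C * R) := by
    intro j s
    have h1 : ∀ i, f^[j] i * C + f^[j] 1 ≤ f^[j] (i + 1) * C := fun i => by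
      have := (hf.iterate_one_le hC j i).2
      nlinarith
    have h2 := add_mul_le_map_add h1 s (C * R)
    by_contra! hlt
    nlinarith
  have hcov : ∀ j s c, c < f^[j] (s + 1) → c + R * f^[j] 1 ≤ f^[j] (s + S') := by
    intro j s c hc
    have := hlow j (s + 1)
    rw [show s + S' = s + 1 + C * R by simp only [S']; ring]
    omega
  have hA : Agree X (α n) (α (n + (r + 1))) S' := fun t ht => (heq t ht).1
  have hB : Agree X (β n) (β (n + (r + 1))) S' := fun t ht => (heq t ht).2
  have transport : ∀ s s' c, Agree X s s' S' → f^[n] s ≤ c → c < f^[n] (s + 1) →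
      ∃ x, Agree X c x (R * f^[n] 1) ∧ f^[n] s' ≤ x ∧ x < f^[n] (s' + 1) := by
    intro s s' c h h1 h2
    obtain ⟨h3, h4⟩ := (hf.iterate n).map_agree h
    have h5 := h3 1 (by omega)
    have h6 := hcov n s c h2
    exact ⟨f^[n] s' + (c - f^[n] s), h4.shift h1 (by omega) (by omega), by omega, by omega⟩
  obtain ⟨x, hx, hx1, hx2⟩ := transport _ _ _ hA (hα n) (hα' n)
  obtain ⟨y, hy, hy1, hy2⟩ := transport _ _ _ hB (hβ n) (hβ' n)
  have hxy : Agree X x y (R * f^[n] 1) := (hx.symm.trans (hab n)).trans hy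
  set m := n + (r + 1) with hmdef
  have hpush : ∀ z, f^[r + 1] (f^[n] z) = f^[m] z := fun z => by
    rw [← Function.iterate_add_apply, hmdef, add_comm]
  have hmono := (hf.iterate (r + 1)).strictMono
  have hX1 := hmono.monotone hx1
  have hX2 := hmono hx2
  have hY1 := hmono.monotone hy1
  have hY2 := hmono hy2
  rw [hpush] at hX1 hX2 hY1 hY2
  obtain ⟨-, hxy'⟩ := (hf.iterate (r + 1)).map_agree hxy
  have hlen : f^[r + 1] x + Q * f^[m] 1 ≤ f^[r + 1] (x + R * f^[n] 1) := by
    have h1 : f^[n] (α m + S) ≤ x + R * f^[n] 1 := by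
      have := map_add_le_of_map_succ_le (fun z => (hf.iterate_one_le hC n z).1) (α m) S
      have h2 : C * f^[n] 1 * S ≤ R * f^[n] 1 := by
        rw [mul_right_comm]
        exact Nat.mul_le_mul_right _ (by omega)
      omega
    have h2 := hmono.monotone h1
    rw [hpush] at h2
    have h3 : ∀ i, f^[m] i * C + f^[m] 1 ≤ f^[m] (i + 1) * C := fun i => by
      have := (hf.iterate_one_le hC m i).2
      nlinarith
    have h4 := add_mul_le_map_add h3 (α m + 1) (C * Q)
    rw [show α m + 1 + C * Q = α m + S by simp only [S]; ring] at h4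
    have h5 : f^[m] (α m + 1) + Q * f^[m] 1 ≤ f^[m] (α m + S) := by
      by_contra! hlt
      nlinarith
    omega
  have ha1 := (hf.iterate_one_le hC m (α m)).1
  have hb1 := (hf.iterate_one_le hC m (β m)).1
  have haα := hα m
  have haα' := hα' m
  have hbβ := hβ m
  have hbβ' := hβ' m
  have hQ : Q * f^[m] 1 = 4 * (C * f^[m] 1) + N * (2 * (C * f^[m] 1)) + f^[m] 1 := by
    simp only [Q]; ring
  have hR : (Q + 2 * C) * f^[m] 1 ≤ R * f^[m] 1 := Nat.mul_le_mul_right _ (by omega)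
  rw [add_mul, hQ] at hR
  have hg := hg0 m
  by_cases hD : f^[r + 1] x + b m = f^[r + 1] y + a m
  · obtain ⟨l, hl⟩ := hf.map_agree_iterate_succ (r := r) hxy (hfk m) (by omega) (by omega)
    exact hno m l (by omega)
  · obtain ⟨q, D, hD0, hD1, hq⟩ := (hab m).exists_repetition hxy' (e := C * f^[m] 1)
      (l := N * (2 * (C * f^[m] 1))) (by omega) (by omega) (by omega) (by omega) hD
      (by nlinarith) (by omega)
    exact hN q D _ hD0 (Nat.mul_le_mul_left _ hD1) hq

end IsCutting

/-- The words that the morphism with cutting function `f` assigns to `X k` and `X l` are equal. -/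
def SameImage {A : Type*} (X : ℕ → A) (f : ℕ → ℕ) (k l : ℕ) : Prop :=
  f (k + 1) + f l = f (l + 1) + f k ∧ Agree X (f k) (f l) (f (k + 1) - f k)

theorem SameImage.trans {A : Type*} {X : ℕ → A} {f : ℕ → ℕ} {k l m : ℕ}
    (h : SameImage X f k l) (h' : SameImage X f l m) : SameImage X f k m :=
  ⟨by have := h.1; have := h'.1; omega,
    h.2.trans (h'.2.mono (by have := h.1; omega))⟩

/-- The cutting points of `f`, together with the letters from which the blocks come, are
determined by windows of radius `L`. -/
def IsRecognizable {A : Type*} (X : ℕ → A) (f : ℕ → ℕ) (L : ℕ) : Prop :=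
  ∀ a b n k s, Agree X a b n → f k = a + s → L ≤ s → s + L ≤ n → ∃ l, f l = b + s ∧ X k = X l

namespace IsCutting

variable {A : Type*} {X : ℕ → A} {f g : ℕ → ℕ}

theorem sameImage_comp (hg : IsCutting X g) (hf : IsCutting X f) {k l : ℕ}
    (h : SameImage X f k l) : SameImage X (g ∘ f) k l := by
  obtain ⟨h1, h2⟩ := h
  have hk := hf.strictMono.monotone (show k ≤ k + 1 by omega)
  have hl := hf.strictMono.monotone (show l ≤ l + 1 by omega)
  obtain ⟨h3, h4⟩ := hg.map_agree h2
  have h5 := h3 _ le_rfl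
  rw [show f k + (f (k + 1) - f k) = f (k + 1) by omega] at h4 h5
  rw [show f l + (f (k + 1) - f k) = f (l + 1) by omega] at h5
  exact ⟨h5, h4⟩

/-- Letters whose images under some power of the morphism are equal already have equal images under
a power that does not depend on the letters. -/
theorem exists_sameImage_stable [Finite A] (hf : IsCutting X f) :
    ∃ N, ∀ n k l, SameImage X f^[n] k l → SameImage X f^[N] k l := by
  classical
  have : Fintype A := Fintype.ofFinite A
  have hmono : ∀ n d k l, SameImage X f^[n] k l → SameImage X f^[n + d] k l := by
    intro n d k l h
    rw [add_comm, Function.iterate_add]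
    exact (hf.iterate d).sameImage_comp (hf.iterate n) h
  have h : ∀ c : A × A, ∃ N, ∀ n k l, X k = c.1 → X l = c.2 → SameImage X f^[n] k l →
      SameImage X f^[N] k l := by
    intro c
    by_cases hc : ∃ n k l, X k = c.1 ∧ X l = c.2 ∧ SameImage X f^[n] k l
    · obtain ⟨N, k, l, hk, hl, h⟩ := hc
      refine ⟨N, fun n k' l' hk' hl' _ => ?_⟩
      have h1 : SameImage X f^[N] k' k := (hf.iterate N).block _ _ (hk'.trans hk.symm)
      have h2 : SameImage X f^[N] l l' := (hf.iterate N).block _ _ (hl.trans hl'.symm)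
      exact (h1.trans h).trans h2
    · exact ⟨0, fun n k l hk hl h => (hc ⟨n, k, l, hk, hl, h⟩).elim⟩
  choose d hd using h
  refine ⟨∑ c, d c, fun n k l h => ?_⟩
  have hle := Finset.single_le_sum (f := d) (fun _ _ => Nat.zero_le _)
    (Finset.mem_univ (X k, X l))
  obtain ⟨e, he⟩ := Nat.exists_eq_add_of_le hle
  rw [he]
  exact hmono _ _ _ _ (hd (X k, X l) n k l rfl rfl h)

theorem exists_isRecognizable [Finite A] (hf : IsCutting X f) {p : ℕ}
    (hm : IsMixing X f^[p]) (hX : ∀ D, 0 < D → ∃ i, X i ≠ X (i + D)) :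
    ∃ L, IsRecognizable X f L := by
  obtain ⟨N, hN⟩ := hf.exists_sameImage_stable
  have hF := hf.iterate (N + 1)
  have hmF : IsMixing X (f^[N + 1])^[p] := by
    rw [← Function.iterate_mul, show (N + 1) * p = p + N * p by ring]
    exact hf.isMixing_iterate_add hm _
  obtain ⟨L, hL⟩ := hF.exists_recognizability hmF hX
  obtain ⟨M, hM⟩ := hF.exists_le_add
  have hcut : ∀ a b n z i j, Agree X a b n → f^[N + 1] z = i → a + L ≤ i → i + L ≤ a + n →
      i + b = j + a → ∃ z', f^[N + 1] z' = j := by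
    intro a b n z i j h hz h1 h2 h3
    obtain ⟨z', hz'⟩ := hL (i - L) (j - L) z (h.shift (by omega) (by omega) (by omega)) (by omega)
    exact ⟨z', by omega⟩
  refine ⟨L + M, fun a b n k s h hk hs hs' => ?_⟩
  obtain ⟨k', h1, h2⟩ := (hf.iterate N).strictMono.exists_between (hf.iterate N).map_zero k
  have h3 := hf.strictMono.monotone h1
  have h4 := hf.strictMono h2
  rw [← Function.iterate_succ_apply' f] at h3 h4
  have h5 := hM k'
  have h6 := hF.strictMono (Nat.lt_succ_self k')
  simp only [Nat.succ_eq_add_one] at h3 h4 h5 h6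
  obtain ⟨l', hl'⟩ := hcut a b n k' _ (f^[N + 1] k' + b - a) h rfl (by omega) (by omega) (by omega)
  obtain ⟨l'', hl''⟩ := hcut a b n (k' + 1) _ (f^[N + 1] (k' + 1) + b - a) h rfl
    (by omega) (by omega) (by omega)
  have h7 : l' < l'' := hF.strictMono.lt_iff_lt.1 (by omega)
  obtain rfl : l'' = l' + 1 := by
    by_contra hne
    have h8 := hF.strictMono (show l' < l' + 1 by omega)
    have h9 := hF.strictMono (show l' + 1 < l'' by omega)
    obtain ⟨z, hz⟩ := hcut b a n (l' + 1) _ (f^[N + 1] (l' + 1) + a - b) h.symm rfl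
      (by omega) (by omega) (by omega)
    have h10 : k' < z := hF.strictMono.lt_iff_lt.1 (by omega)
    have h11 : z < k' + 1 := hF.strictMono.lt_iff_lt.1 (by omega)
    omega
  have hsame : SameImage X f^[N + 1] k' l' :=
    ⟨by omega, h.shift (by omega) (by omega) (by omega)⟩
  obtain ⟨h8, h9⟩ := hN _ _ _ hsame
  have h10 := (hf.map_agree h9).1 (k - f^[N] k') (by omega)
  rw [← Function.iterate_succ_apply' f N k', ← Function.iterate_succ_apply' f N l',
    show f^[N] k' + (k - f^[N] k') = k by omega] at h10
  simp only [Nat.succ_eq_add_one] at h10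
  exact ⟨f^[N] l' + (k - f^[N] k'), by omega, h9.eq_of_offset h1 (by omega) (by omega)⟩

end IsCutting

theorem StrictMono.add_le_map_add {f : ℕ → ℕ} (hf : StrictMono f) (k n : ℕ) :
    f k + n ≤ f (k + n) := by
  induction n with
  | zero => simp
  | succ n ih => have := hf (show k + n < k + (n + 1) by omega); omega

namespace IsRecognizable

variable {A : Type*} {X : ℕ → A} {f : ℕ → ℕ} {L : ℕ}

/-- A synchronized pair of desubstitutions extends to the right. -/
theorem agree_right (hr : IsRecognizable X f L) (hf : IsCutting X f) {k l Q T : ℕ}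
    (h : Agree X k l Q) (hQ : L + 1 ≤ Q) (h' : Agree X (f k) (f l) T) (s : ℕ)
    (hs : f (k + s) + L ≤ f k + T) : Agree X k l (s + 1) := by
  induction s with
  | zero => exact h.mono (by omega)
  | succ s ih =>
    have hlt := hf.strictMono (show k + s < k + (s + 1) by omega)
    have h1 := ih (by omega)
    by_cases hsQ : s + 1 + 1 ≤ Q
    · exact h.mono hsQ
    · have h2 := (hf.map_agree h1).1 _ le_rfl
      have h3 := hf.strictMono.add_le_map_add k (s + 1)
      obtain ⟨z, hz, hXz⟩ := hr _ _ _ (k + (s + 1)) (f (k + (s + 1)) - f k) h' (by omega)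
        (by omega) (by omega)
      obtain rfl : z = l + (s + 1) := hf.strictMono.injective (by omega)
      refine h1.append fun t ht => ?_
      obtain rfl : t = 0 := by omega
      exact hXz

/-- A synchronized pair of desubstitutions extends to the left. -/
theorem agree_left (hr : IsRecognizable X f L) (hf : IsCutting X f) {k l Q a b T : ℕ}
    (h : Agree X k l Q) (hQ : L ≤ Q) (ha : a + T = f k) (hb : b + T = f l)
    (h' : Agree X a b T) (s : ℕ) (hs : s ≤ k) (hsL : a + L ≤ f (k - s)) :
    s ≤ l ∧ Agree X (k - s) (l - s) s := by
  induction s with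
  | zero => exact ⟨Nat.zero_le _, fun t ht => by omega⟩
  | succ s ih =>
    have hlt := hf.strictMono (show k - (s + 1) < k - s by omega)
    obtain ⟨h1, h2⟩ := ih (by omega) (by omega)
    have hle : f (k - s) ≤ f k := hf.strictMono.monotone (by omega)
    have h3 := (hf.map_agree h2).1 _ le_rfl
    rw [show k - s + s = k by omega, show l - s + s = l by omega] at h3
    have h4 := (hf.map_agree h).2
    have h5 := hf.strictMono.add_le_map_add k Q
    have h6 : Agree X a b (T + Q) := h'.append (by rw [ha, hb]; exact h4.mono (by omega))
    obtain ⟨z, hz, hXz⟩ := hr _ _ _ (k - (s + 1)) (f (k - (s + 1)) - a) h6 (by omega) (by omega)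
      (by omega)
    have h7 := (hf.block _ _ hXz).1
    rw [show k - (s + 1) + 1 = k - s by omega] at h7
    have h8 : z + 1 = l - s := hf.strictMono.injective (by omega)
    obtain rfl : z = l - (s + 1) := by omega
    refine ⟨by omega, ?_⟩
    have h9 : Agree X (k - (s + 1)) (l - (s + 1)) 1 := fun t ht => by
      obtain rfl : t = 0 := by omega
      exact hXz
    have h10 := h9.append (m := s) (by
      rwa [show k - (s + 1) + 1 = k - s by omega, show l - (s + 1) + 1 = l - s by omega])
    rwa [add_comm 1 s] at h10

/-- Two words with the same image are equal if they begin with a common long word, and if they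
have long suffixes that occur in `X` followed by a common long word. -/
theorem agree_of_image_agree (hr : IsRecognizable X f L) (hf : IsCutting X f) {M : ℕ}
    (hM : ∀ k, f (k + 1) ≤ f k + M) {k l n m Q T B k₀ l₀ k₁ l₁ : ℕ}
    (hkl : Agree X k l Q) (hQ : L + 1 ≤ Q) (hn : f (k + n) = f k + T) (hm : f (l + m) = f l + T)
    (hT : Agree X (f k) (f l) T) (hB : 2 * L + M ≤ B) (hBn : B ≤ n) (hBm : B ≤ m)
    (hk₀ : k₀ + B = k + n) (hl₀ : l₀ + B = l + m) (hk₁ : Agree X k₁ k₀ B)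
    (hl₁ : Agree X l₁ l₀ B) (h₁ : Agree X (k₁ + B) (l₁ + B) Q) : n = m ∧ Agree X k l n := by
  have hTn := hf.strictMono.add_le_map_add k n
  have hTm := hf.strictMono.add_le_map_add l m
  obtain ⟨z, hz, hz'⟩ := hf.strictMono.exists_between hf.map_zero (f (k + n) - L)
  have hMz := hM z
  have hzk : k ≤ z := by
    by_contra! hlt
    have := hf.strictMono.monotone (show z + 1 ≤ k by omega)
    omega
  obtain ⟨s, rfl⟩ := Nat.exists_eq_add_of_le hzk
  have h1 : Agree X k l s := (hr.agree_right hf hkl hQ hT s (by omega)).mono (by omega)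
  have h2 := (hf.map_agree h1).1 s le_rfl
  have hsn : s ≤ n := by
    have := hf.strictMono.le_iff_le.1 (show f (k + s) ≤ f (k + n) by omega)
    omega
  have hsm : s ≤ m := by
    have := hf.strictMono.le_iff_le.1 (show f (l + s) ≤ f (l + m) by omega)
    omega
  obtain ⟨c, rfl⟩ := Nat.exists_eq_add_of_le hsn
  obtain ⟨d, rfl⟩ := Nat.exists_eq_add_of_le hsm
  have hc := hf.strictMono.add_le_map_add (k + s) c
  have hd := hf.strictMono.add_le_map_add (l + s) d
  rw [add_assoc] at hc hd
  obtain ⟨hk2, hk3⟩ := hf.map_agree hk₁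
  obtain ⟨hl2, hl3⟩ := hf.map_agree hl₁
  have hk4 := hk2 B le_rfl
  have hl4 := hl2 B le_rfl
  have hk5 := hk2 (B - c) (by omega)
  have hl5 := hl2 (B - d) (by omega)
  have hk6 := hf.strictMono.add_le_map_add k₁ B
  have hl6 := hf.strictMono.add_le_map_add l₁ B
  rw [hk₀] at hk4
  rw [hl₀] at hl4
  rw [show k₀ + (B - c) = k + s by omega] at hk5
  rw [show l₀ + (B - d) = l + s by omega] at hl5
  have e1 : Agree X (f (k₁ + B) - B) (f (k + (s + c)) - B) B :=
    hk3.shift (by omega) (by omega) (by omega)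
  have e2 : Agree X (f (k + (s + c)) - B) (f (l + (s + d)) - B) B :=
    hT.shift (by omega) (by omega) (by omega)
  have e3 : Agree X (f (l₁ + B) - B) (f (l + (s + d)) - B) B :=
    hl3.shift (by omega) (by omega) (by omega)
  obtain ⟨-, h3⟩ := hr.agree_left hf h₁ (by omega) (by omega) (by omega)
    ((e1.trans e2).trans e3.symm) c (by omega) (by
      rw [show k₁ + B - c = k₁ + (B - c) by omega]
      omega)
  rw [show k₁ + B - c = k₁ + (B - c) by omega, show l₁ + B - c = l₁ + (B - c) by omega] at h3
  have h4 := (hf.map_agree h3).1 c le_rfl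
  rw [show k₁ + (B - c) + c = k₁ + B by omega, show l₁ + (B - c) + c = l₁ + B by omega] at h4
  have h5 : l₁ + (B - c) = l₁ + (B - d) := hf.strictMono.injective (by omega)
  obtain rfl : c = d := by omega
  refine ⟨rfl, h1.append ?_⟩
  have e4 : Agree X (k₁ + (B - c)) (k + s) c := hk₁.shift (by omega) (by omega) (by omega)
  have e5 : Agree X (l₁ + (B - c)) (l + s) c := hl₁.shift (by omega) (by omega) (by omega)
  exact (e4.symm.trans h3).trans e5

end IsRecognizable

section Words

variable {A B : Type*}

@[simp]
theorem length_factorAt (X : ℕ → A) (k n : ℕ) : (factorAt X k n).length = n := by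
  simp [factorAt]

@[simp]
theorem factorAt_zero (X : ℕ → A) (k : ℕ) : factorAt X k 0 = [] := rfl

theorem factorAt_succ (X : ℕ → A) (k n : ℕ) :
    factorAt X k (n + 1) = factorAt X k n ++ [X (k + n)] := by
  simp [factorAt, List.range_succ]

theorem factorAt_add (X : ℕ → A) (k n m : ℕ) :
    factorAt X k (n + m) = factorAt X k n ++ factorAt X (k + n) m := by
  induction m with
  | zero => simp
  | succ m ih => rw [← add_assoc, factorAt_succ, ih, factorAt_succ, List.append_assoc, add_assoc]

theorem factorAt_eq_iff {X : ℕ → A} {a b n : ℕ} :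
    factorAt X a n = factorAt X b n ↔ Agree X a b n := by
  simp [factorAt, Agree]

theorem factorAt_prefix (X : ℕ → A) (k : ℕ) {n m : ℕ} (h : n ≤ m) :
    factorAt X k n <+: factorAt X k m := by
  obtain ⟨d, rfl⟩ := Nat.exists_eq_add_of_le h
  rw [factorAt_add]
  exact List.prefix_append _ _

theorem eq_factorAt_of_prefix {X : ℕ → A} {w : List A} {k n : ℕ} (h : w <+: factorAt X k n) :
    w = factorAt X k w.length := by
  have hle := h.length_le
  rw [length_factorAt] at hle
  exact (List.prefix_of_prefix_length_le h (factorAt_prefix X k hle) (by simp)).eq_of_length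
    (by simp)

theorem append_eq_factorAt {X : ℕ → A} {v w : List A} {k n : ℕ} (h : v ++ w = factorAt X k n) :
    v = factorAt X k v.length ∧ w = factorAt X (k + v.length) w.length := by
  have hn : n = v.length + w.length := by
    have := congrArg List.length h
    simpa using this.symm
  rw [hn, factorAt_add] at h
  exact List.append_inj h (by simp)

@[simp]
theorem wordMap_nil (φ : A → List B) : wordMap φ [] = [] := rfl

@[simp]
theorem wordMap_cons (φ : A → List B) (a : A) (w : List A) :
    wordMap φ (a :: w) = φ a ++ wordMap φ w := rfl

@[simp]
theorem wordMap_append (φ : A → List B) (v w : List A) :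
    wordMap φ (v ++ w) = wordMap φ v ++ wordMap φ w := List.flatMap_append

theorem length_le_length_wordMap {φ : A → List B} (hφ : ∀ a, φ a ≠ []) (w : List A) :
    w.length ≤ (wordMap φ w).length := by
  induction w with
  | nil => simp
  | cons a w ih =>
    have := List.length_pos_of_ne_nil (hφ a)
    simp only [wordMap_cons, List.length_append, List.length_cons]
    omega

theorem eq_nil_of_wordMap_eq_nil {φ : A → List B} (hφ : ∀ a, φ a ≠ []) {w : List A}
    (h : wordMap φ w = []) : w = [] := by
  have := length_le_length_wordMap hφ w
  rw [h] at this
  simpa using this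

theorem List.IsPrefix.eq_of_wordMap_eq {φ : A → List B} (hφ : ∀ a, φ a ≠ []) {v w : List A}
    (h : v <+: w) (he : wordMap φ v = wordMap φ w) : v = w := by
  obtain ⟨z, rfl⟩ := h
  rw [wordMap_append, List.self_eq_append_right] at he
  rw [eq_nil_of_wordMap_eq_nil hφ he, List.append_nil]

/-- The position at which the image of the letter `X k` begins in the image of `X`. -/
def cut (φ : A → List B) (X : ℕ → A) (k : ℕ) : ℕ :=
  (wordMap φ (factorAt X 0 k)).length

theorem cut_add (φ : A → List B) (X : ℕ → A) (k n : ℕ) :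
    cut φ X (k + n) = cut φ X k + (wordMap φ (factorAt X k n)).length := by
  rw [cut, factorAt_add, wordMap_append, List.length_append, zero_add, cut]

theorem cut_zero (φ : A → List B) (X : ℕ → A) : cut φ X 0 = 0 := rfl

theorem cut_strictMono {φ : A → List B} (hφ : ∀ a, φ a ≠ []) (X : ℕ → A) :
    StrictMono (cut φ X) := by
  refine strictMono_nat_of_lt_succ fun k => ?_
  have := length_le_length_wordMap hφ (factorAt X k 1)
  rw [length_factorAt] at this
  rw [cut_add]
  omega

theorem MapsSeqTo.wordMap_factorAt {φ : A → List B} {X : ℕ → A} {Y : ℕ → B}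
    (h : MapsSeqTo φ X Y) (k n : ℕ) :
    wordMap φ (factorAt X k n) =
      factorAt Y (cut φ X k) (wordMap φ (factorAt X k n)).length := by
  have h1 := h (k + n)
  rw [IsPrefixOf, factorAt_add, wordMap_append, zero_add] at h1
  have h2 := (append_eq_factorAt h1).2
  rwa [zero_add] at h2

theorem MapsSeqTo.image_eq_factorAt {φ : A → List B} {X : ℕ → A} {Y : ℕ → B}
    (h : MapsSeqTo φ X Y) (k : ℕ) : φ (X k) = factorAt Y (cut φ X k) (φ (X k)).length := by
  have := h.wordMap_factorAt k 1
  simpa [factorAt_succ] using this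

theorem cut_succ (φ : A → List B) (X : ℕ → A) (k : ℕ) :
    cut φ X (k + 1) = cut φ X k + (φ (X k)).length := by
  rw [cut_add]
  simp [factorAt_succ]

end Words

namespace Substitution

variable {A : Type*} {τ : Substitution A} {X : ℕ → A}

theorem IsFixedPoint.isCutting (hX : τ.IsFixedPoint X) : IsCutting X (cut τ.image X) where
  strictMono := cut_strictMono τ.image_ne_nil X
  map_zero := cut_zero _ _
  block k l h := by
    have h1 := hX.2.image_eq_factorAt k
    have h2 := hX.2.image_eq_factorAt l
    rw [cut_succ, cut_succ, h]
    refine ⟨by ring, ?_⟩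
    rw [h] at h1
    rw [Nat.add_sub_cancel_left, ← factorAt_eq_iff, ← h1, ← h2]

theorem IsFixedPoint.exists_of_matrix_pow_ne_zero [Fintype A] [DecidableEq A]
    (hX : τ.IsFixedPoint X) (n : ℕ) (i : A) (l : ℕ) (h : (τ.matrix ^ n) i (X l) ≠ 0) :
    ∃ t, (cut τ.image X)^[n] l ≤ t ∧ t < (cut τ.image X)^[n] (l + 1) ∧ X t = i := by
  induction n generalizing l with
  | zero =>
    rw [pow_zero, Matrix.one_apply] at h
    have h' : i = X l := by
      by_contra hne
      simp [hne] at h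
    exact ⟨l, le_rfl, Nat.lt_succ_self l, h'.symm⟩
  | succ n ih =>
    rw [pow_succ, Matrix.mul_apply] at h
    obtain ⟨c, -, hc⟩ := Finset.exists_ne_zero_of_sum_ne_zero h
    have hc1 := left_ne_zero_of_mul hc
    have hc2 : c ∈ τ.image (X l) := by
      have := right_ne_zero_of_mul hc
      rw [Substitution.matrix, Matrix.of_apply] at this
      exact List.count_pos_iff.1 (Nat.pos_of_ne_zero (by exact_mod_cast this))
    have h1 := hX.2.image_eq_factorAt l
    rw [h1, factorAt, List.mem_map] at hc2
    obtain ⟨s, hs, hs'⟩ := hc2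
    rw [List.mem_range] at hs
    obtain ⟨t, h2, h3, h4⟩ := ih (cut τ.image X l + s) (by rwa [hs'])
    have hmono := (hX.isCutting.iterate n).strictMono.monotone
    refine ⟨t, ?_, ?_, h4⟩
    · rw [Function.iterate_succ_apply]
      exact (hmono (by omega)).trans h2
    · rw [Function.iterate_succ_apply]
      refine h3.trans_le (hmono ?_)
      rw [cut_succ]
      omega

theorem IsPrimitive.exists_isMixing [Fintype A] [DecidableEq A] (hτ : τ.IsPrimitive)
    (hX : τ.IsFixedPoint X) : ∃ p, IsMixing X (cut τ.image X)^[p] := by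
  obtain ⟨p, -, hp⟩ := Matrix.IsPrimitive.exists_pos_pow hτ
  exact ⟨p, fun k l => hX.exists_of_matrix_pow_ne_zero p _ k (hp _ _).ne'⟩

end Substitution

theorem exists_ne_add_of_not_ultimatelyPeriodic {A : Type*} {X : ℕ → A}
    (h : ¬ UltimatelyPeriodic X) (D : ℕ) (hD : 0 < D) : ∃ i, X i ≠ X (i + D) := by
  by_contra! hcon
  exact h ⟨0, D, hD, fun n _ => (hcon n).symm⟩

section ReturnWords

variable {A : Type*} {X : ℕ → A} {u : List A}

theorem IsPrefixOf.isOccurrence_zero (hu : IsPrefixOf u X) : IsOccurrence X u 0 :=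
  hu.symm

theorem IsOccurrence.agree {i j : ℕ} (hi : IsOccurrence X u i) (hj : IsOccurrence X u j) :
    Agree X i j u.length :=
  factorAt_eq_iff.1 (hi.trans hj.symm)

theorem ne_nil_of_mem_returnWords {r : List A} (hr : r ∈ returnWords X u) : r ≠ [] := by
  obtain ⟨i, j, hij, -, -, -, rfl⟩ := hr
  intro h
  have := congrArg List.length h
  simp at this
  omega

/-- A return word, followed by `u`, begins with `u`. -/
theorem prefix_append_of_mem_returnWords {r : List A} (hr : r ∈ returnWords X u) :
    u <+: r ++ u := by
  obtain ⟨i, j, hij, hi, hj, -, rfl⟩ := hr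
  have h : factorAt X i (j - i) ++ u = factorAt X i (j - i + u.length) := by
    rw [factorAt_add, show i + (j - i) = j by omega, hj]
  rw [h]
  have := factorAt_prefix X i (show u.length ≤ j - i + u.length by omega)
  rwa [hi] at this

/-- The return words on long prefixes of an aperiodic sequence are long. -/
theorem exists_le_length_of_mem_returnWords (hX : ∀ D, 0 < D → ∃ i, X i ≠ X (i + D)) (B : ℕ) :
    ∃ n₀, ∀ u, IsPrefixOf u X → n₀ < u.length → ∀ r ∈ returnWords X u, B ≤ r.length := by
  have h : ∀ D, ∃ i, 0 < D → X i ≠ X (i + D) := fun D => by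
    by_cases hD : 0 < D
    · obtain ⟨i, hi⟩ := hX D hD
      exact ⟨i, fun _ => hi⟩
    · exact ⟨0, fun h => (hD h).elim⟩
  choose d hd using h
  refine ⟨∑ D ∈ Finset.range B, (d D + D), fun u hu hlen r hr => ?_⟩
  obtain ⟨i, j, hij, hi, hj, -, rfl⟩ := hr
  by_contra! hlt
  rw [length_factorAt] at hlt
  have hle := Finset.single_le_sum (f := fun D => d D + D) (fun _ _ => Nat.zero_le _)
    (Finset.mem_range.2 hlt)
  have h1 := (hu.isOccurrence_zero.agree hi).eq_of_offset (i := d (j - i) + (j - i))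
    (j := i + (d (j - i) + (j - i))) (by omega) (by omega) (by omega)
  have h2 := (hu.isOccurrence_zero.agree hj).eq_of_offset (i := d (j - i))
    (j := j + d (j - i)) (by omega) (by omega) (by omega)
  rw [show i + (d (j - i) + (j - i)) = j + d (j - i) by omega] at h1
  exact hd (j - i) (by omega) (h2.trans h1.symm)

/-- No return word followed by `u` begins with a shorter return word followed by `u`. -/
theorem length_eq_of_append_prefix {r s z : List A} (hr : r ∈ returnWords X u)
    (hs : s ∈ returnWords X u) (hrz : r ++ u <+: z) (hsz : s ++ u <+: z) :
    r.length = s.length := by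
  have key : ∀ r s, r ∈ returnWords X u → s ∈ returnWords X u → r ++ u <+: z → s ++ u <+: z →
      ¬ r.length < s.length := by
    intro r s hr hs hrz hsz hlt
    have hpos := List.length_pos_of_ne_nil (ne_nil_of_mem_returnWords hr)
    obtain ⟨i, j, hij, hi, hj, hno, rfl⟩ := hs
    have h : factorAt X i (j - i) ++ u = factorAt X i (j - i + u.length) := by
      rw [factorAt_add, show i + (j - i) = j by omega, hj]
    rw [length_factorAt] at hlt
    have h1 : r ++ u <+: factorAt X i (j - i) ++ u :=
      List.prefix_of_prefix_length_le hrz hsz (by simp; omega)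
    rw [h] at h1
    have h2 := (append_eq_factorAt (eq_factorAt_of_prefix h1)).2
    exact hno (i + r.length) (by omega) (by omega) h2.symm
  have h1 := key r s hr hs hrz hsz
  have h2 := key s r hs hr hsz hrz
  omega

section Coding

variable {R : Type*} {θ : R → List A}

theorem prefix_wordMap_append (hθ : ∀ r, θ r ∈ returnWords X u) (v : List R) :
    u <+: wordMap θ v ++ u := by
  induction v with
  | nil => simp
  | cons r v ih =>
    rw [wordMap_cons, List.append_assoc]
    exact (prefix_append_of_mem_returnWords (hθ r)).trans
      ((List.prefix_append_right_inj _).2 ih)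

/-- Concatenations of return words can be decoded, given the word `u` that follows. -/
theorem prefix_or_prefix_of_wordMap (hθ : ∀ r, θ r ∈ returnWords X u)
    (hinj : Function.Injective θ) (v w : List R) (z : List A) (hv : wordMap θ v ++ u <+: z)
    (hw : wordMap θ w ++ u <+: z) : v <+: w ∨ w <+: v := by
  induction v generalizing w z with
  | nil => exact Or.inl List.nil_prefix
  | cons r v ih =>
    rcases w with _ | ⟨s, w⟩
    · exact Or.inr List.nil_prefix
    · rw [wordMap_cons, List.append_assoc] at hv hw
      have h1 := ((List.prefix_append_right_inj (θ r)).2 (prefix_wordMap_append hθ v)).trans hv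
      have h2 := ((List.prefix_append_right_inj (θ s)).2 (prefix_wordMap_append hθ w)).trans hw
      have hlen := length_eq_of_append_prefix (hθ r) (hθ s) h1 h2
      have h3 : θ r = θ s := (List.prefix_of_prefix_length_le
        ((List.prefix_append _ _).trans h1) ((List.prefix_append _ _).trans h2)
        hlen.le).eq_of_length hlen
      obtain rfl := hinj h3
      obtain ⟨z', rfl⟩ := (List.prefix_append _ _).trans hv
      rw [List.prefix_append_right_inj] at hv hw
      simpa using ih w z' hv hw

theorem wordMap_injective (hθ : ∀ r, θ r ∈ returnWords X u) (hinj : Function.Injective θ) :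
    Function.Injective (wordMap θ) := by
  intro v w h
  have hne : ∀ r, θ r ≠ [] := fun r => ne_nil_of_mem_returnWords (hθ r)
  rcases prefix_or_prefix_of_wordMap hθ hinj v w (wordMap θ v ++ u) (List.prefix_refl _)
    (by rw [h]) with h' | h'
  · exact h'.eq_of_wordMap_eq hne h
  · exact (h'.eq_of_wordMap_eq hne h.symm).symm

theorem eq_of_mapsSeqTo (hθ : ∀ r, θ r ∈ returnWords X u) (hinj : Function.Injective θ)
    {Y Z : ℕ → R} (hY : MapsSeqTo θ Y X) (hZ : MapsSeqTo θ Z X) : Y = Z := by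
  have hne : ∀ r, θ r ≠ [] := fun r => ne_nil_of_mem_returnWords (hθ r)
  have hpre : ∀ {Y : ℕ → R}, MapsSeqTo θ Y X → ∀ n, ∃ m, ∀ m' ≥ m,
      wordMap θ (factorAt Y 0 n) ++ u <+: factorAt X 0 m' := by
    intro Y hY n
    have h1 := hY (n + u.length)
    rw [IsPrefixOf] at h1
    refine ⟨(wordMap θ (factorAt Y 0 (n + u.length))).length, fun m' hm' =>
      List.IsPrefix.trans ?_ (factorAt_prefix X 0 hm')⟩
    rw [← h1, factorAt_add, wordMap_append, List.prefix_append_right_inj]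
    refine List.prefix_of_prefix_length_le (prefix_wordMap_append hθ _)
      (List.prefix_append _ _) ?_
    have := length_le_length_wordMap hne (factorAt Y (0 + n) u.length)
    rwa [length_factorAt] at this
  funext n
  obtain ⟨m, hm⟩ := hpre hY (n + 1)
  obtain ⟨l, hl⟩ := hpre hZ (n + 1)
  have h1 := prefix_or_prefix_of_wordMap hθ hinj _ _ _ (hm (max m l) (le_max_left _ _))
    (hl (max m l) (le_max_right _ _))
  have h2 : factorAt Y 0 (n + 1) = factorAt Z 0 (n + 1) := by
    rcases h1 with h1 | h1
    · exact h1.eq_of_length (by simp)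
    · exact (h1.eq_of_length (by simp)).symm
  rw [factorAt_succ, factorAt_succ] at h2
  simpa using (List.append_inj h2 (by simp)).2

/-- The word between two occurrences of `u` is a concatenation of return words. -/
theorem exists_wordMap_eq_factorAt (hsurj : ∀ r ∈ returnWords X u, ∃ s, θ s = r) {i j : ℕ}
    (hij : i ≤ j) (hi : IsOccurrence X u i) (hj : IsOccurrence X u j) :
    ∃ v, wordMap θ v = factorAt X i (j - i) := by
  classical
  induction hd : j - i using Nat.strong_induction_on generalizing i with
  | _ d ih =>
    subst hd
    rcases hij.eq_or_lt with rfl | hlt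
    · exact ⟨[], by simp⟩
    · have hex : ∃ k, i < k ∧ IsOccurrence X u k := ⟨j, hlt, hj⟩
      obtain ⟨h1, h2⟩ := Nat.find_spec hex
      have h3 : Nat.find hex ≤ j := Nat.find_min' hex ⟨hlt, hj⟩
      have h4 : ∀ k, i < k → k < Nat.find hex → ¬ IsOccurrence X u k :=
        fun k hk hk' ho => Nat.find_min hex hk' ⟨hk, ho⟩
      generalize Nat.find hex = k at *
      obtain ⟨s, hs⟩ := hsurj _ ⟨i, k, h1, hi, h2, h4, rfl⟩
      obtain ⟨v, hv⟩ := ih (j - k) (by omega) h3 h2 rfl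
      refine ⟨s :: v, ?_⟩
      rw [wordMap_cons, hs, hv, show j - i = (k - i) + (j - k) by omega, factorAt_add,
        show i + (k - i) = k by omega]

end Coding

section ReturnCoding

theorem returnBlock_mem (hinf : (Set.ofPred (IsOccurrence X u)).Infinite) (n : ℕ) :
    returnBlock X u n ∈ returnWords X u := by
  have hmono := Nat.nth_strictMono hinf
  refine ⟨_, _, hmono (Nat.lt_succ_self n), Nat.nth_mem_of_infinite hinf _,
    Nat.nth_mem_of_infinite hinf _, fun k hk hk' ho => ?_, rfl⟩
  obtain ⟨m, rfl⟩ : k ∈ Set.range (Nat.nth (IsOccurrence X u)) := by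
    rw [Nat.range_nth_of_infinite hinf]; exact ho
  rw [hmono.lt_iff_lt] at hk hk'
  omega

theorem exists_isFirstAppearance (hinf : (Set.ofPred (IsOccurrence X u)).Infinite)
    {r : List A} (hr : r ∈ returnWords X u) :
    ∃ n, IsFirstAppearance X u n ∧ returnBlock X u n = r := by
  classical
  have hex : ∃ n, returnBlock X u n = r := by
    obtain ⟨i, j, hij, hi, hj, hno, rfl⟩ := hr
    have hmono := Nat.nth_strictMono hinf
    have hrange := Nat.range_nth_of_infinite hinf
    obtain ⟨n, rfl⟩ : i ∈ Set.range (Nat.nth (IsOccurrence X u)) := by rw [hrange]; exact hi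
    obtain ⟨m, rfl⟩ : j ∈ Set.range (Nat.nth (IsOccurrence X u)) := by rw [hrange]; exact hj
    rw [hmono.lt_iff_lt] at hij
    obtain rfl : m = n + 1 := by
      by_contra hne
      exact hno _ (hmono (Nat.lt_succ_self n)) (hmono (show n + 1 < m by omega))
        (Nat.nth_mem_of_infinite hinf _)
    exact ⟨n, rfl⟩
  refine ⟨Nat.find hex, fun k hk h => Nat.find_min hex hk ?_, Nat.find_spec hex⟩
  rw [h, Nat.find_spec hex]

theorem injOn_returnBlock : Set.InjOn (returnBlock X u) (Set.ofPred (IsFirstAppearance X u)) := by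
  intro n hn m hm h
  rcases lt_trichotomy n m with hlt | rfl | hlt
  · exact (hm n hlt h).elim
  · rfl
  · exact (hn m hlt h.symm).elim

theorem image_returnBlock (hinf : (Set.ofPred (IsOccurrence X u)).Infinite) :
    returnBlock X u '' Set.ofPred (IsFirstAppearance X u) = returnWords X u := by
  ext r
  constructor
  · rintro ⟨n, -, rfl⟩
    exact returnBlock_mem hinf n
  · exact exists_isFirstAppearance hinf

theorem finite_isFirstAppearance (hinf : (Set.ofPred (IsOccurrence X u)).Infinite)
    (hfin : (returnWords X u).Finite) : (Set.ofPred (IsFirstAppearance X u)).Finite :=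
  Set.Finite.of_finite_image (by rwa [image_returnBlock hinf]) injOn_returnBlock

theorem card_isFirstAppearance (hinf : (Set.ofPred (IsOccurrence X u)).Infinite)
    (h : (Set.ofPred (IsFirstAppearance X u)).Finite) :
    h.toFinset.card = (returnWords X u).ncard := by
  rw [← Set.ncard_eq_toFinset_card _ h, ← image_returnBlock hinf,
    injOn_returnBlock.ncard_image]

theorem returnCoding_mem (hinf : (Set.ofPred (IsOccurrence X u)).Infinite)
    (r : ReturnAlphabet X u) : returnCoding X u r ∈ returnWords X u :=
  returnBlock_mem hinf _

theorem returnCoding_injective (hinf : (Set.ofPred (IsOccurrence X u)).Infinite)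
    (hfin : (returnWords X u).Finite) : Function.Injective (returnCoding X u) := by
  intro r s h
  have hF := finite_isFirstAppearance hinf hfin
  have hlt : ∀ t : ReturnAlphabet X u, (t : ℕ) < hF.toFinset.card := fun t => by
    rw [card_isFirstAppearance hinf hF]
    exact t.2
  have h1 := injOn_returnBlock (Nat.nth_mem_of_lt_card hF (hlt r))
    (Nat.nth_mem_of_lt_card hF (hlt s)) h
  exact Fin.ext (Nat.nth_injOn hF (hlt r) (hlt s) h1)

theorem exists_returnCoding_eq (hinf : (Set.ofPred (IsOccurrence X u)).Infinite)
    (hfin : (returnWords X u).Finite) (r : List A) (hr : r ∈ returnWords X u) :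
    ∃ s, returnCoding X u s = r := by
  have hF := finite_isFirstAppearance hinf hfin
  obtain ⟨n, hn, rfl⟩ := exists_isFirstAppearance hinf hr
  obtain ⟨k, hk, rfl⟩ := Nat.exists_lt_card_finite_nth_eq hF hn
  rw [card_isFirstAppearance hinf hF] at hk
  exact ⟨⟨k, hk⟩, rfl⟩

theorem exists_isDerivedSequence (hu : IsPrefixOf u X)
    (hinf : (Set.ofPred (IsOccurrence X u)).Infinite) (hfin : (returnWords X u).Finite) :
    ∃ Y, IsDerivedSequence X u Y := by
  choose Y hY using fun n => exists_returnCoding_eq hinf hfin _ (returnBlock_mem hinf n)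
  have h : ∀ n, wordMap (returnCoding X u) (factorAt Y 0 n) =
      factorAt X 0 (Nat.nth (IsOccurrence X u) n) := by
    intro n
    induction n with
    | zero => simp [Nat.nth_zero_of_zero hu.isOccurrence_zero]
    | succ n ih =>
      have hle := Nat.nth_strictMono hinf (Nat.lt_succ_self n)
      simp only [Nat.succ_eq_add_one] at hle
      rw [factorAt_succ, wordMap_append, ih, wordMap_cons, wordMap_nil, List.append_nil, zero_add,
        hY, returnBlock]
      obtain ⟨d, hd⟩ := Nat.exists_eq_add_of_le hle.le
      rw [hd, Nat.add_sub_cancel_left, factorAt_add, zero_add]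
  refine ⟨Y, fun n => ?_⟩
  rw [IsPrefixOf, h, length_factorAt]

end ReturnCoding

end ReturnWords

section Recurrence

variable {A : Type*} {X : ℕ → A} {u : List A}

theorem infinite_isOccurrence {G : ℕ}
    (hG : ∀ a, ∃ t, a ≤ t ∧ t ≤ a + G ∧ IsOccurrence X u t) :
    (Set.ofPred (IsOccurrence X u)).Infinite := by
  refine Set.infinite_of_forall_exists_gt fun a => ?_
  obtain ⟨t, h1, -, h2⟩ := hG (a + 1)
  exact ⟨t, h2, h1⟩

theorem finite_returnWords [Finite A] {G : ℕ}
    (hG : ∀ a, ∃ t, a ≤ t ∧ t ≤ a + G ∧ IsOccurrence X u t) : (returnWords X u).Finite := by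
  refine (List.finite_length_le A (G + 1)).subset ?_
  rintro r ⟨i, j, hij, -, -, hno, rfl⟩
  rw [Set.mem_ofPred_eq, length_factorAt]
  by_contra! hlt
  obtain ⟨t, h1, h2, h3⟩ := hG (i + 1)
  exact hno t (by omega) (by omega) h3

end Recurrence

section Injectivity

variable {A : Type*} {τ : Substitution A} {X : ℕ → A} {u : List A}

theorem Substitution.IsFixedPoint.isOccurrence_cut (hX : τ.IsFixedPoint X) (hu : IsPrefixOf u X)
    {i : ℕ} (hi : IsOccurrence X u i) : IsOccurrence X u (cut τ.image X i) := by
  have h1 := (hX.isCutting.map_agree (hu.isOccurrence_zero.agree hi)).2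
  have h2 := hX.isCutting.strictMono.add_le_map_add 0 u.length
  rw [cut_zero] at h1 h2
  have h3 := factorAt_eq_iff.2 (h1.mono (m := u.length) (by omega))
  exact h3.symm.trans hu.isOccurrence_zero

theorem exists_isReturnSubstitution (hX : τ.IsFixedPoint X) (hu : IsPrefixOf u X)
    (hinf : (Set.ofPred (IsOccurrence X u)).Infinite) (hfin : (returnWords X u).Finite) :
    ∃ σ, IsReturnSubstitution τ X u σ := by
  have h : ∀ r : ReturnAlphabet X u, ∃ v, wordMap (returnCoding X u) v =
      wordMap τ.image (returnCoding X u r) := by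
    intro r
    obtain ⟨i, j, hij, hi, hj, -, hr⟩ := returnCoding_mem hinf r
    obtain ⟨v, hv⟩ := exists_wordMap_eq_factorAt (exists_returnCoding_eq hinf hfin)
      (hX.isCutting.strictMono.monotone hij.le) (hX.isOccurrence_cut hu hi)
      (hX.isOccurrence_cut hu hj)
    obtain ⟨d, rfl⟩ := Nat.exists_eq_add_of_lt hij
    refine ⟨v, ?_⟩
    rw [hv, hr, hX.2.wordMap_factorAt, add_assoc, cut_add, Nat.add_sub_cancel_left,
      Nat.add_sub_cancel_left]
  choose σ hσ using h
  exact ⟨σ, hσ⟩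

theorem wordMap_wordMap_of_isReturnSubstitution {σ : ReturnAlphabet X u → List (ReturnAlphabet X u)}
    (hσ : IsReturnSubstitution τ X u σ) (v : List (ReturnAlphabet X u)) :
    wordMap (returnCoding X u) (wordMap σ v) = wordMap τ.image (wordMap (returnCoding X u) v) := by
  induction v with
  | nil => rfl
  | cons r v ih => rw [wordMap_cons, wordMap_append, hσ, ih, wordMap_cons, wordMap_append]

theorem IsDerivedSequence.wordMap_mem_language {Y : ℕ → ReturnAlphabet X u}
    (hY : IsDerivedSequence X u Y) {v : List (ReturnAlphabet X u)} (hv : v ∈ language Y) :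
    wordMap (returnCoding X u) v ∈ language X := by
  obtain ⟨k, n, rfl⟩ := hv
  exact ⟨_, _, MapsSeqTo.wordMap_factorAt hY k n⟩

/-- If a factor of `X` is a non-empty concatenation of return words of length at least `B`, then its
last `B` letters also occur in `X` followed by `u`. -/
theorem exists_agree_suffix {R : Type*} {θ : R → List A} (hθ : ∀ r, θ r ∈ returnWords X u)
    {B : ℕ} (hB : ∀ r ∈ returnWords X u, B ≤ r.length) {v : List R} (hv : v ≠ []) {k n : ℕ}
    (h : wordMap θ v = factorAt X k n) :
    ∃ k₀ k₁, k₀ + B = k + n ∧ B ≤ n ∧ Agree X k₁ k₀ B ∧ IsOccurrence X u (k₁ + B) := by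
  obtain ⟨v', r, rfl⟩ := List.eq_nil_or_concat v |>.resolve_left hv
  rw [List.concat_eq_append, wordMap_append, wordMap_cons, wordMap_nil, List.append_nil] at h
  have hlen := congrArg List.length h
  have h1 := (append_eq_factorAt h).2
  have h2 := hB _ (hθ r)
  obtain ⟨i, j, hij, hi, hj, -, hr⟩ := hθ r
  rw [hr, length_factorAt] at h2
  rw [hr, length_factorAt, factorAt_eq_iff] at h1
  rw [hr, List.length_append, length_factorAt, length_factorAt] at hlen
  refine ⟨k + n - B, j - B, by omega, by omega, h1.shift (by omega) (by omega) (by omega), ?_⟩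
  rwa [show j - B + B = j by omega]

theorem injOn_wordMap_image {R : Type*} {θ : R → List A} (hX : τ.IsFixedPoint X)
    (hθ : ∀ r, θ r ∈ returnWords X u) {L M : ℕ}
    (hL : IsRecognizable X (cut τ.image X) L)
    (hM : ∀ k, cut τ.image X (k + 1) ≤ cut τ.image X k + M)
    (hB : ∀ r ∈ returnWords X u, 2 * L + M ≤ r.length) (huL : L < u.length) :
    Set.InjOn (wordMap τ.image) (language X ∩ Set.range (wordMap θ)) := by
  rintro w ⟨⟨k, n, hw⟩, v, hv⟩ w' ⟨⟨l, m, hw'⟩, v', hv'⟩ heq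
  have hcomp : w <+: w' ∨ w' <+: w → w = w' := fun h => h.elim
    (fun h => h.eq_of_wordMap_eq τ.image_ne_nil heq)
    (fun h => (h.eq_of_wordMap_eq τ.image_ne_nil heq.symm).symm)
  have h1 := prefix_wordMap_append hθ v
  have h2 := prefix_wordMap_append hθ v'
  rw [hv] at h1
  rw [hv'] at h2
  rcases le_total w.length u.length with h3 | h3
  · have h4 : w <+: w' ++ u :=
      (List.prefix_of_prefix_length_le (List.prefix_append _ _) h1 h3).trans h2
    exact hcomp (List.prefix_or_prefix_of_prefix h4 (List.prefix_append _ _))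
  rcases le_total w'.length u.length with h4 | h4
  · have h5 : w' <+: w ++ u :=
      (List.prefix_of_prefix_length_le (List.prefix_append _ _) h2 h4).trans h1
    exact hcomp (List.prefix_or_prefix_of_prefix (List.prefix_append _ _) h5)
  have hvne : v ≠ [] := by
    rintro rfl
    rw [← hv, wordMap_nil, List.length_nil] at h3
    omega
  have hvne' : v' ≠ [] := by
    rintro rfl
    rw [← hv', wordMap_nil, List.length_nil] at h4
    omega
  have hk : IsOccurrence X u k := by
    have := List.prefix_of_prefix_length_le h1 (List.prefix_append w u) h3
    rw [hw] at this
    exact (eq_factorAt_of_prefix this).symm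
  have hl : IsOccurrence X u l := by
    have := List.prefix_of_prefix_length_le h2 (List.prefix_append w' u) h4
    rw [hw'] at this
    exact (eq_factorAt_of_prefix this).symm
  obtain ⟨k₀, k₁, hk₀, hBn, hk₁, hk₁u⟩ := exists_agree_suffix hθ hB hvne (hv.trans hw)
  obtain ⟨l₀, l₁, hl₀, hBm, hl₁, hl₁u⟩ := exists_agree_suffix hθ hB hvne' (hv'.trans hw')
  have hT : Agree X (cut τ.image X k) (cut τ.image X l)
      (wordMap τ.image (factorAt X k n)).length := by
    rw [← factorAt_eq_iff, ← hX.2.wordMap_factorAt, ← hw, heq, hw', ← hX.2.wordMap_factorAt]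
  obtain ⟨rfl, h5⟩ := hL.agree_of_image_agree hX.isCutting hM (hk.agree hl) huL
    (cut_add _ _ _ _) (by rw [cut_add, ← hw, heq, hw']) hT le_rfl hBn hBm hk₀ hl₀ hk₁ hl₁
    (hk₁u.agree hl₁u)
  rw [hw, hw', factorAt_eq_iff]
  exact h5

end Injectivity

theorem mainTheorem7 {A : Type*} [Fintype A] [DecidableEq A] (τ : Substitution A)
    (hτ : τ.IsPrimitive) (X : ℕ → A) (hX : τ.IsFixedPoint X) (hper : ¬ UltimatelyPeriodic X) :
    ∃ n₀ : ℕ, ∀ u : List A, IsPrefixOf u X → n₀ < u.length →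
      Set.InjOn (wordMap τ.image) (language X ∩ Set.range (wordMap (returnCoding X u))) ∧
      (∃! Y, IsDerivedSequence X u Y) ∧
      (∃! σ, IsReturnSubstitution τ X u σ) ∧
      ∀ Y σ, IsDerivedSequence X u Y → IsReturnSubstitution τ X u σ →
        Set.InjOn (wordMap σ) (language Y) := by
  have hne := exists_ne_add_of_not_ultimatelyPeriodic hper
  obtain ⟨p, hm⟩ := hτ.exists_isMixing hX
  obtain ⟨L, hL⟩ := hX.isCutting.exists_isRecognizable hm hne
  obtain ⟨M, hM⟩ := hX.isCutting.exists_le_add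
  obtain ⟨K, hK⟩ := hX.isCutting.exists_linear_recurrence hm (hne 1 one_pos)
  obtain ⟨n₀, hn₀⟩ := exists_le_length_of_mem_returnWords hne (2 * L + M)
  refine ⟨n₀ + L, fun u hu hlen => ?_⟩
  have hG : ∀ a, ∃ t, a ≤ t ∧ t ≤ a + K * u.length ∧ IsOccurrence X u t := fun a => by
    obtain ⟨t, h1, h2, h3⟩ := hK u.length (by omega) 0 a
    exact ⟨t, h1, h2, (factorAt_eq_iff.2 h3).symm.trans hu.isOccurrence_zero⟩
  have hinf := infinite_isOccurrence hG
  have hfin := finite_returnWords hG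
  have hθ := returnCoding_mem hinf
  have hinj := returnCoding_injective hinf hfin
  have hcode := wordMap_injective hθ hinj
  have hτinj := injOn_wordMap_image hX hθ hL hM (hn₀ u hu (by omega)) (by omega)
  refine ⟨hτinj, ?_, ?_, fun Y σ hY hσ v hv w hw h => ?_⟩
  · obtain ⟨Y, hY⟩ := exists_isDerivedSequence hu hinf hfin
    exact ⟨Y, hY, fun Z hZ => eq_of_mapsSeqTo hθ hinj hZ hY⟩
  · obtain ⟨σ, hσ⟩ := exists_isReturnSubstitution hX hu hinf hfin
    exact ⟨σ, hσ, fun σ' hσ' => funext fun r => hcode ((hσ' r).trans (hσ r).symm)⟩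
  · refine hcode (hτinj ⟨hY.wordMap_mem_language hv, v, rfl⟩
      ⟨hY.wordMap_mem_language hw, w, rfl⟩ ?_)
    rw [← wordMap_wordMap_of_isReturnSubstitution hσ, h,
      wordMap_wordMap_of_isReturnSubstitution hσ]
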